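/- Let $\mathcal X$ be a compact metric space and let $\mathcal H$ be a reproducing kernel Hilbert space of real functions on $\mathcal X$ with (measurable) kernel $k$ satisfying $k(x,x)\le 1$ for all $x$; write $\phi(x)=k(x,\cdot)$. Let $G,H$ be Borel probability measures on $\mathcal X$, let $\kappa^*\in[0,1)$, $F=(1-\kappa^*)G+\kappa^*H$ and $\lambda^*=1/(1-\kappa^*)$. Let $\alpha>0$ and $\beta\in\mathbb R$, and suppose that the separability condition with margin $\alpha$ and tolerance $\beta$ holds: there is $h\in\mathcal H$ with $\|h\|_{\mathcal H}\le 1$ and $$\mathbf E_{X\sim G}\,h(X)\;\le\;\inf_x h(x)+\beta\;\le\;\mathbf E_{X\sim H}\,h(X)-\alpha .$$ Let $x_1,\dots,x_n$ be drawn from $F$ and $x_{n+1},\dots,x_{n+m}$ from $H$, all independently. For $\lambda\ge 0$ put $$\hat d(\lambda)=\inf_{w\in\mathcal C_S}\Big\|\frac{\lambda}{n}\sum_{i=1}^n\phi(x_i)+\frac{1-\lambda}{m}\sum_{i=n+1}^{n+m}\phi(x_i)-w\Big\|_{\mathcal H},\qquad \mathcal C_S=\Big\{\sum_{i=1}^{n+m}a_i\phi(x_i):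 a_i\ge 0,\ \sum_i a_i=1\Big\},$$ a convex function on $[0,\infty)$ with subdifferential $\partial\hat d(\lambda)=\{g:\hat d(t)\ge\hat d(\lambda)+g(t-\lambda)\ \text{for all } t\ge 0\}$, and let $\hat\lambda^G_\nu=\inf\{\lambda\ge 0:\exists g\in\partial\hat d(\lambda),\ g\ge\nu\}$ be the gradient thresholding estimator. Let $\delta\in(0,\tfrac14]$, $\nu\in\big[\frac{\alpha}{4\lambda^*},\frac{3\alpha}{4\lambda^*}\big]$ and $\sqrt{\min(m,n)}\ge \frac{36\sqrt{\log(1/\delta)}}{\alpha/\lambda^*-\nu}$. Then with probability at least $1-4\delta$ the infimum defining $\hat\lambda^G_\nu$ is over a nonempty set, and $$\lambda^*-\hat\lambda^G_\nu\;\le\; c\,\sqrt{\log(1/\delta)}\,(\min(m,n))^{-1/2},\qquad \hat\lambda^G_\nu-\lambda^*\;\le\;\frac{4\beta\lambda^*}{\alpha}+c'\,\sqrt{\log(1/\delta)}\,(\min(m,n))^{-1/2},$$ where $c=(2\lambda^*-1+\sqrt{2\lambda^*})\cdot\frac{12\lambda^*}{\alpha}$ and $c'=\frac{144(\lambda^*)^2(\alpha+4\beta)}{\alpha^2}$.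 -/

import Mathlib

open MeasureTheory ProbabilityTheory

noncomputable section

namespace MPE

/-- The real-valued kernel `k(x, y)` of a reproducing kernel Hilbert space `H` of real functions
on `X`. -/
def kern {X : Type*} (H : Type*) [NormedAddCommGroup H] [InnerProductSpace ℝ H]
    [CompleteSpace H] [RKHS ℝ H X ℝ] (x y : X) : ℝ :=
  RKHS.kernel H x y 1

/-- The feature map `φ(x) = k(x, ·) ∈ H`. -/
def feature {X : Type*} (H : Type*) [NormedAddCommGroup H] [InnerProductSpace ℝ H]
    [CompleteSpace H] [RKHS ℝ H X ℝ] (x : X) : H :=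
  RKHS.kerFun H x 1

/-- The separability condition with margin `α` and tolerance `β`: there is `h` in the unit ball of
`H` with `E_G h ≤ inf h + β ≤ E_H h - α`. -/
def Separable {X : Type*} [MeasurableSpace X] (H : Type*) [NormedAddCommGroup H]
    [InnerProductSpace ℝ H] [RKHS ℝ H X ℝ] (G Hd : Measure X) (α β : ℝ) : Prop :=
  ∃ h : H, ‖h‖ ≤ 1 ∧ ∫ x, h x ∂G ≤ (⨅ x, h x) + β ∧ (⨅ x, h x) + β ≤ ∫ x, h x ∂Hd - α

/-- The mean embedding of the empirical distribution of a finite sample `x`. -/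
def empMean {X : Type*} (H : Type*) [NormedAddCommGroup H] [InnerProductSpace ℝ H]
    [CompleteSpace H] [RKHS ℝ H X ℝ] {n : ℕ} (x : Fin n → X) : H :=
  (n : ℝ)⁻¹ • ∑ i, feature H (x i)

/-- The set of all convex combinations of the embedded points of both samples. -/
def sampleHull {X : Type*} (H : Type*) [NormedAddCommGroup H] [InnerProductSpace ℝ H]
    [CompleteSpace H] [RKHS ℝ H X ℝ] {n m : ℕ} (x : Fin n → X) (y : Fin m → X) : Set H :=
  {w | ∃ a ∈ stdSimplex ℝ (Fin n ⊕ Fin m), w = ∑ i, a i • feature H (Sum.elim x y i)}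

/-- The empirical distance function
`l ↦ inf_{w ∈ C_S} ‖l φ(F̂) + (1 - l) φ(Ĥ) - w‖`. -/
def dHat {X : Type*} (H : Type*) [NormedAddCommGroup H] [InnerProductSpace ℝ H]
    [CompleteSpace H] [RKHS ℝ H X ℝ] {n m : ℕ} (x : Fin n → X) (y : Fin m → X) (l : ℝ) : ℝ :=
  ⨅ w : sampleHull H x y, ‖l • empMean H x + (1 - l) • empMean H y - (w : H)‖

/-- The subdifferential at `l` of a real function `f` with domain `s`. -/
def subdifferential (s : Set ℝ) (f : ℝ → ℝ) (l : ℝ) : Set ℝ :=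
  {g | ∀ t ∈ s, f l + g * (t - l) ≤ f t}

/-- The points `l ≥ 0` at which the empirical distance function, as a function on `[0, ∞)`, has a
subgradient that is at least `ν`. -/
def gradThreshSet {X : Type*} (H : Type*) [NormedAddCommGroup H] [InnerProductSpace ℝ H]
    [CompleteSpace H] [RKHS ℝ H X ℝ] {n m : ℕ} (x : Fin n → X) (y : Fin m → X) (ν : ℝ) : Set ℝ :=
  {l | 0 ≤ l ∧ ∃ g ∈ subdifferential (Set.Ici 0) (dHat H x y) l, ν ≤ g}

/-- The gradient thresholding estimator. -/
def gradEstimator {X : Type*} (H : Type*) [NormedAddCommGroup H] [InnerProductSpace ℝ H]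
    [CompleteSpace H] [RKHS ℝ H X ℝ] {n m : ℕ} (x : Fin n → X) (y : Fin m → X) (ν : ℝ) : ℝ :=
  sInf (gradThreshSet H x y ν)

end MPE

end

/-! Write `lam` for λ*, and `mF`, `mG`, `mH` for the mean embeddings, so that `lam • mF + (1 - lam)
• mH = mG`. On an event of probability at least 1 - 4δ the empirical means are within `e = 3 * L /
√N` of `mF` and `mH`, where `L = √(log (1/δ))` and `N = min m n`, and some point of the sample hull
is within `√(2 * lam) * e` of `mG`. Everything else is deterministic.

At `lam` the empirical distance is small, by `dHat_le_of_embedding`. Beyond `lam` it grows at rate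
about `α / lam`, up to the loss `β`: the separating function `h` is at least its infimum on every
hull point, while its value at the extrapolated mean falls below that infimum
(`le_dHat_of_separating`). By convexity, the average slope from `lam` to `lam + D` is a lower bound
for some subgradient at `lam + D`; `D` is chosen to make this slope at least `ν`, so the estimator
is at most `lam + D`. Conversely, a subgradient at least `ν` at some `t ≤ lam` forces the
nonnegative function to climb by `ν * (lam - t)`, so `lam - t` is at most its value at `lam` divided
by `ν` (`sub_gradEstimator_le`).

Concentration comes from a Pinelis argument giving a dimension-free Bernstein inequality
(`pi_norm_sum_ge_le`). It is used for the two means, and, with weights given by the density of G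
with respect to F (at most `lam`), for a self-normalised hull point near `mG`
(`exists_event_dist_sampleHull_le`). -/

noncomputable section

namespace MPE

open scoped RealInnerProductSpace

/-! ### Hyperbolic cosine inequalities behind Pinelis' method. -/

/-- `u ↦ cosh √u` is convex on the nonnegative half-line. -/
lemma cosh_sqrt_convexComb_le {u v a b : ℝ} (hu : 0 ≤ u) (hv : 0 ≤ v) (ha : 0 ≤ a) (hb : 0 ≤ b)
    (hab : a + b = 1) :
    Real.cosh √(a * u + b * v) ≤ a * Real.cosh √u + b * Real.cosh √v := by
  have key : ∀ {w : ℝ}, 0 ≤ w →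
      HasSum (fun k : ℕ => w ^ k / ((2 * k).factorial : ℝ)) (Real.cosh √w) := by
    intro w hw
    have := Real.hasSum_cosh √w
    simpa [pow_mul, Real.sq_sqrt hw] using this
  refine hasSum_le (fun k => ?_) (key (by positivity))
    (((key hu).mul_left a).add ((key hv).mul_left b))
  have h := (convexOn_pow k).2 (Set.mem_Ici.2 hu) (Set.mem_Ici.2 hv) ha hb hab
  simp only [smul_eq_mul] at h
  rw [← mul_div_assoc, ← mul_div_assoc, ← add_div]
  gcongr

/-- The argument of the root lies between `(a - b) ^ 2` and `(a + b) ^ 2`, so convexity of `cosh ∘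
√` bounds the left side by the chord, which the addition formulas evaluate. With `c = ⟪s, z⟫` this
is a second-order expansion of `cosh ‖s + z‖` whose linear term vanishes on averaging. -/
lemma cosh_sqrt_add_le {a b c : ℝ} (ha : 0 ≤ a) (hb : 0 ≤ b) (hc : |c| ≤ a * b) :
    Real.cosh √(a ^ 2 + 2 * c + b ^ 2) ≤
      Real.cosh a + Real.sinh a / a * c + Real.cosh a * (Real.exp b - 1 - b) := by
  have hexp : Real.exp b = Real.cosh b + Real.sinh b := (Real.cosh_add_sinh b).symm
  have hsb : b ≤ Real.sinh b := Real.self_le_sinh_iff.2 hb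
  rcases ha.eq_or_lt with rfl | ha
  · have : c = 0 := by simpa using hc
    subst this
    simp only [ne_eq, OfNat.ofNat_ne_zero, not_false_eq_true, zero_pow, mul_zero, zero_add,
      Real.sqrt_sq hb, Real.cosh_zero, add_zero, one_mul]
    linarith
  rcases hb.eq_or_lt with rfl | hb
  · have : c = 0 := by simpa using hc
    subst this
    simp [Real.sqrt_sq ha.le]
  have hab : 0 < a * b := mul_pos ha hb
  have hc' := abs_le.1 hc
  -- The barycentric coordinate of `a ^ 2 + 2 * c + b ^ 2` between the two extreme squares.
  set t := (1 + c / (a * b)) / 2 with ht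
  have hct : c = (2 * t - 1) * (a * b) := by rw [ht]; field_simp; ring
  have ht0 : 0 ≤ t := by
    have : -1 ≤ c / (a * b) := by rw [le_div_iff₀ hab]; linarith
    rw [ht]; linarith
  have ht1 : 0 ≤ 1 - t := by
    have : c / (a * b) ≤ 1 := by rw [div_le_iff₀ hab]; linarith
    rw [ht]; linarith
  have h := cosh_sqrt_convexComb_le (sq_nonneg (a + b)) (sq_nonneg (a - b)) ht0 ht1 (by ring)
  rw [Real.sqrt_sq_eq_abs, Real.sqrt_sq_eq_abs, Real.cosh_abs, Real.cosh_abs, Real.cosh_add,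
    Real.cosh_sub] at h
  have e1 : t * (a + b) ^ 2 + (1 - t) * (a - b) ^ 2 = a ^ 2 + 2 * c + b ^ 2 := by rw [hct]; ring
  have e2 : Real.sinh a / a * c = (2 * t - 1) * b * Real.sinh a := by rw [hct]; field_simp
  rw [e1] at h
  rw [e2, hexp]
  refine h.trans ?_
  have hsc : Real.sinh a ≤ Real.cosh a := (Real.sinh_lt_cosh a).le
  have hs0 : 0 ≤ Real.sinh a := Real.sinh_nonneg_iff.2 ha.le
  have hq : 0 ≤ Real.sinh b - b := by linarith
  have p1 := mul_nonneg hq (sub_nonneg.2 hsc)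
  have p2 : 0 ≤ (Real.sinh b - b) * Real.sinh a := mul_nonneg hq hs0
  nlinarith [mul_nonneg ht1 p2]

/-! ### Bernstein inequality in a Hilbert space, with measurability tested by inner products. -/

section Inner

variable {X : Type*} [MeasurableSpace X]
  {H : Type*} [NormedAddCommGroup H] [InnerProductSpace ℝ H]

/-- Measurability of a map into a Hilbert space, tested only through inner products; it does not
require the range to be separable. -/
structure InnerMeasurable (z : X → H) : Prop where
  inner_left : ∀ f : H, Measurable fun x => ⟪f, z x⟫
  inner_pair : Measurable fun p : X × X => ⟪z p.1, z p.2⟫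

namespace InnerMeasurable

variable {z : X → H}

lemma inner_comp {Y : Type*} [MeasurableSpace Y] (hz : InnerMeasurable z) {f g : Y → X}
    (hf : Measurable f) (hg : Measurable g) : Measurable fun y => ⟪z (f y), z (g y)⟫ :=
  hz.inner_pair.comp (hf.prodMk hg)

lemma norm (hz : InnerMeasurable z) : Measurable fun x => ‖z x‖ := by
  have h : (fun x => ‖z x‖) = fun x => √⟪z x, z x⟫ := by
    funext x; rw [real_inner_self_eq_norm_sq, Real.sqrt_sq (norm_nonneg _)]
  rw [h]
  exact (hz.inner_comp measurable_id measurable_id).sqrt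

lemma sub_const (hz : InnerMeasurable z) (c : H) : InnerMeasurable fun x => z x - c where
  inner_left f := by
    simp_rw [inner_sub_right]
    exact (hz.inner_left f).sub_const _
  inner_pair := by
    simp_rw [inner_sub_right, inner_sub_left, real_inner_comm c]
    exact (hz.inner_pair.sub ((hz.inner_left c).comp measurable_snd)).sub
      (((hz.inner_left c).comp measurable_fst).sub_const _)

lemma smul (hz : InnerMeasurable z) {r : X → ℝ} (hr : Measurable r) :
    InnerMeasurable fun x => r x • z x where
  inner_left f := by
    simp_rw [real_inner_smul_right]
    exact hr.mul (hz.inner_left f)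
  inner_pair := by
    simp_rw [real_inner_smul_right, real_inner_smul_left]
    exact (hr.comp measurable_snd).mul ((hr.comp measurable_fst).mul hz.inner_pair)

lemma of_real {r : X → ℝ} (hr : Measurable r) : InnerMeasurable r where
  inner_left f := by
    simp only [RCLike.inner_apply, conj_trivial]
    exact hr.mul_const f
  inner_pair := by
    simp only [RCLike.inner_apply, conj_trivial]
    exact (hr.comp measurable_snd).mul (hr.comp measurable_fst)

lemma norm_add_sum (hz : InnerMeasurable z) {ι Y : Type*} [Fintype ι] [MeasurableSpace Y]
    (s : H) {g : ι → Y → X} (hg : ∀ i, Measurable (g i)) :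
    Measurable fun y => ‖s + ∑ i, z (g i y)‖ := by
  have h : (fun y => ‖s + ∑ i, z (g i y)‖) = fun y => √(⟪s, s⟫ + 2 * ∑ i, ⟪s, z (g i y)⟫ +
      ∑ i, ∑ j, ⟪z (g i y), z (g j y)⟫) := by
    funext y
    rw [← Real.sqrt_sq (norm_nonneg (s + ∑ i, z (g i y))), norm_add_sq_real,
      ← real_inner_self_eq_norm_sq, ← real_inner_self_eq_norm_sq, inner_sum, sum_inner]
    simp_rw [inner_sum]
  rw [h]
  refine Measurable.sqrt ?_
  refine (measurable_const.add ((Finset.measurable_sum _ fun i _ => ?_).const_mul 2)).add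
    (Finset.measurable_sum _ fun i _ => Finset.measurable_sum _ fun j _ => ?_)
  · exact (hz.inner_left s).comp (hg i)
  · exact hz.inner_comp (hg i) (hg j)

end InnerMeasurable

variable {μ : Measure X} [IsProbabilityMeasure μ] {z : X → H}

/-- One step of the supermartingale: centering kills the linear term, `exp b - 1 - b ≤ b ^ 2` for `0
≤ b ≤ 1` leaves the variance, and `1 + v ≤ exp v`. -/
lemma lintegral_cosh_norm_add_le (hz : InnerMeasurable z) (h0 : ∀ f : H, ∫ x, ⟪f, z x⟫ ∂μ = 0)
    (hb : ∀ᵐ x ∂μ, ‖z x‖ ≤ 1) {v : ℝ} (hv : ∫ x, ‖z x‖ ^ 2 ∂μ ≤ v) (s : H) :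
    ∫⁻ x, ENNReal.ofReal (Real.cosh ‖s + z x‖) ∂μ ≤
      ENNReal.ofReal (Real.cosh ‖s‖ * Real.exp v) := by
  set c := Real.sinh ‖s‖ / ‖s‖
  have hpt : ∀ᵐ x ∂μ, Real.cosh ‖s + z x‖ ≤
      Real.cosh ‖s‖ + c * ⟪s, z x⟫ + Real.cosh ‖s‖ * ‖z x‖ ^ 2 := by
    filter_upwards [hb] with x hx
    have h := cosh_sqrt_add_le (norm_nonneg s) (norm_nonneg (z x))
      (abs_real_inner_le_norm s (z x))
    rw [← norm_add_sq_real, Real.sqrt_sq (norm_nonneg _)] at h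
    refine h.trans ?_
    have := (le_abs_self _).trans (Real.abs_exp_sub_one_sub_id_le
      (x := ‖z x‖) (by rwa [abs_of_nonneg (norm_nonneg _)]))
    have := (Real.cosh_pos ‖s‖).le
    gcongr
  have hi1 : Integrable (fun x => ⟪s, z x⟫) μ := by
    refine Integrable.of_bound (hz.inner_left s).aestronglyMeasurable ‖s‖ ?_
    filter_upwards [hb] with x hx
    exact (abs_real_inner_le_norm s (z x)).trans (mul_le_of_le_one_right (norm_nonneg _) hx)
  have hi2 : Integrable (fun x => ‖z x‖ ^ 2) μ := by
    refine Integrable.of_bound (hz.norm.pow_const 2).aestronglyMeasurable 1 ?_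
    filter_upwards [hb] with x hx
    rw [Real.norm_of_nonneg (by positivity)]
    exact pow_le_one₀ (norm_nonneg _) hx
  have hi3 : Integrable (fun x => Real.cosh ‖s‖ + c * ⟪s, z x⟫) μ :=
    (integrable_const _).add (hi1.const_mul c)
  have hi : Integrable (fun x => Real.cosh ‖s‖ + c * ⟪s, z x⟫ + Real.cosh ‖s‖ * ‖z x‖ ^ 2) μ :=
    hi3.add (hi2.const_mul _)
  calc ∫⁻ x, ENNReal.ofReal (Real.cosh ‖s + z x‖) ∂μ
      ≤ ∫⁻ x, ENNReal.ofReal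
          (Real.cosh ‖s‖ + c * ⟪s, z x⟫ + Real.cosh ‖s‖ * ‖z x‖ ^ 2) ∂μ :=
        lintegral_mono_ae (hpt.mono fun x hx => ENNReal.ofReal_le_ofReal hx)
    _ = ENNReal.ofReal
          (∫ x, (Real.cosh ‖s‖ + c * ⟪s, z x⟫ + Real.cosh ‖s‖ * ‖z x‖ ^ 2) ∂μ) :=
        (ofReal_integral_eq_lintegral_ofReal hi
          (hpt.mono fun x hx => (Real.cosh_pos _).le.trans hx)).symm
    _ ≤ _ := by
        refine ENNReal.ofReal_le_ofReal ?_
        rw [integral_add hi3 (hi2.const_mul _),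
          integral_add (integrable_const _) (hi1.const_mul c), integral_const_mul,
          integral_const_mul, h0 s]
        simp only [integral_const, probReal_univ, one_smul, mul_zero, add_zero]
        have := Real.add_one_le_exp v
        have hc := (Real.cosh_pos ‖s‖).le
        nlinarith [mul_le_mul_of_nonneg_left hv hc, mul_le_mul_of_nonneg_left this hc]

/-- Pinelis' bound on the exponential moment of the norm of a sum of independent centered
bounded vectors. -/
lemma lintegral_pi_cosh_norm_add_sum_le (hz : InnerMeasurable z)
    (h0 : ∀ f : H, ∫ x, ⟪f, z x⟫ ∂μ = 0) (hb : ∀ᵐ x ∂μ, ‖z x‖ ≤ 1) {v : ℝ}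
    (hv : ∫ x, ‖z x‖ ^ 2 ∂μ ≤ v) (n : ℕ) (s : H) :
    ∫⁻ x, ENNReal.ofReal (Real.cosh ‖s + ∑ i, z (x i)‖) ∂Measure.pi (fun _ : Fin n => μ) ≤
      ENNReal.ofReal (Real.cosh ‖s‖ * Real.exp (n * v)) := by
  induction n generalizing s with
  | zero => simp
  | succ n ih =>
    have hmeas : Measurable fun p : X × (Fin n → X) =>
        ENNReal.ofReal (Real.cosh ‖(s + z p.1) + ∑ i, z (p.2 i)‖) := by
      refine ENNReal.measurable_ofReal.comp (Real.measurable_cosh.comp ?_)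
      have h := hz.norm_add_sum s (ι := Fin (n + 1)) (Y := X × (Fin n → X))
        (g := Fin.cons (fun p => p.1) fun i p => p.2 i) (fun i => by
          refine Fin.cases ?_ (fun i => ?_) i
          · exact measurable_fst
          · exact (measurable_pi_apply i).comp measurable_snd)
      simpa [Fin.sum_univ_succ, add_assoc] using h
    have hmp := measurePreserving_piFinSuccAbove (fun _ : Fin (n + 1) => μ) 0
    have e : ∫⁻ x, ENNReal.ofReal (Real.cosh ‖s + ∑ i, z (x i)‖)
          ∂Measure.pi (fun _ : Fin (n + 1) => μ) =
        ∫⁻ p : X × (Fin n → X), ENNReal.ofReal (Real.cosh ‖(s + z p.1) + ∑ i, z (p.2 i)‖)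
          ∂μ.prod (Measure.pi fun _ : Fin n => μ) := by
      rw [← hmp.lintegral_comp hmeas]
      refine lintegral_congr fun x => ?_
      simp [Fin.sum_univ_succ, add_assoc, Fin.tail]
    rw [e, lintegral_prod _ hmeas.aemeasurable]
    calc _ ≤ ∫⁻ x, ENNReal.ofReal (Real.exp (n * v)) *
            ENNReal.ofReal (Real.cosh ‖s + z x‖) ∂μ := by
          refine lintegral_mono fun x => ?_
          refine (ih (s + z x)).trans_eq ?_
          rw [mul_comm, ENNReal.ofReal_mul (Real.exp_pos _).le]
      _ ≤ ENNReal.ofReal (Real.exp (n * v)) *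
            ENNReal.ofReal (Real.cosh ‖s‖ * Real.exp v) := by
          rw [lintegral_const_mul' _ _ ENNReal.ofReal_ne_top]
          gcongr
          exact lintegral_cosh_norm_add_le hz h0 hb hv s
      _ = _ := by
          rw [← ENNReal.ofReal_mul (Real.exp_pos _).le]
          congr 1
          push_cast
          rw [add_mul, one_mul, Real.exp_add]
          ring

/-- A Bernstein inequality for the norm of a sum of independent centered bounded vectors. -/
theorem pi_norm_sum_ge_le (hz : InnerMeasurable z)
    (h0 : ∀ f : H, ∫ x, ⟪f, z x⟫ ∂μ = 0) {b v ε : ℝ} (hb : ∀ᵐ x ∂μ, ‖z x‖ ≤ b)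
    (hv0 : 0 < v) (hv : ∫ x, ‖z x‖ ^ 2 ∂μ ≤ v) (hε : 0 ≤ ε) (hεb : ε * b ≤ 2 * v) (n : ℕ) :
    Measure.pi (fun _ : Fin n => μ) {x | n * ε ≤ ‖∑ i, z (x i)‖} ≤
      ENNReal.ofReal (2 * Real.exp (-(n * ε ^ 2 / (4 * v)))) := by
  -- The minimiser of `n * t ^ 2 * v - t * n * ε`; the hypothesis `ε * b ≤ 2 * v` says exactly that
  -- the rescaled bound `t * b` is at most 1.
  set t := ε / (2 * v)
  have ht : 0 ≤ t := by positivity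
  have hzt : InnerMeasurable fun x => t • z x := hz.smul measurable_const
  have key := lintegral_pi_cosh_norm_add_sum_le (μ := μ) (v := t ^ 2 * v) hzt
    (fun f => by simp_rw [real_inner_smul_right]; rw [integral_const_mul, h0, mul_zero])
    (by
      filter_upwards [hb] with x hx
      rw [norm_smul, Real.norm_of_nonneg ht]
      calc t * ‖z x‖ ≤ t * b := by gcongr
        _ = ε * b / (2 * v) := by ring
        _ ≤ 1 := by rw [div_le_one (by positivity)]; exact hεb)
    (by
      simp_rw [norm_smul, mul_pow, Real.norm_of_nonneg ht]
      rw [integral_const_mul]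
      gcongr) n 0
  simp only [← Finset.smul_sum, zero_add, norm_zero, Real.cosh_zero, one_mul] at key
  set a := Real.exp (t * (n * ε)) / 2 with ha
  have ha0 : 0 < a := by positivity
  have hmeas : Measurable fun x : Fin n → X => ENNReal.ofReal (Real.cosh ‖t • ∑ i, z (x i)‖) := by
    refine ENNReal.measurable_ofReal.comp (Real.measurable_cosh.comp ?_)
    have h := hzt.norm_add_sum 0 (ι := Fin n) (g := fun i (x : Fin n → X) => x i)
      fun i => measurable_pi_apply i
    simpa [← Finset.smul_sum] using h
  have hmk := mul_meas_ge_le_lintegral (μ := Measure.pi fun _ : Fin n => μ) hmeas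
    (ENNReal.ofReal a)
  have hsub : {x : Fin n → X | n * ε ≤ ‖∑ i, z (x i)‖} ⊆
      {x | ENNReal.ofReal a ≤ ENNReal.ofReal (Real.cosh ‖t • ∑ i, z (x i)‖)} := by
    intro x hx
    refine ENNReal.ofReal_le_ofReal ?_
    rw [norm_smul, Real.norm_of_nonneg ht, Real.cosh_eq, ha]
    have h1 : Real.exp (t * (n * ε)) ≤ Real.exp (t * ‖∑ i, z (x i)‖) :=
      Real.exp_le_exp.2 (mul_le_mul_of_nonneg_left hx ht)
    have := Real.exp_pos (-(t * ‖∑ i, z (x i)‖))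
    linarith
  refine (measure_mono hsub).trans ?_
  have hle := hmk.trans key
  rw [mul_comm, ← ENNReal.le_div_iff_mul_le (Or.inl (by simpa using ha0))
    (Or.inl ENNReal.ofReal_ne_top), ← ENNReal.ofReal_div_of_pos ha0] at hle
  refine hle.trans_eq ?_
  congr 1
  rw [ha, div_div_eq_mul_div, mul_comm, mul_div_assoc, ← Real.exp_sub]
  congr 2
  simp only [t]
  field_simp
  ring

end Inner

/-! ### Subgradients from slopes. -/

/-- A convex function on the half-line whose slope between `a` and `b` is at least `ν` has a
subgradient at `b` that is at least `ν`. -/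
lemma exists_subgradient_ge {f : ℝ → ℝ} (hf : ConvexOn ℝ (Set.Ici 0) f) {a b ν : ℝ} (ha : 0 ≤ a)
    (hab : a < b) (h : ν * (b - a) ≤ f b - f a) :
    ∃ g ∈ subdifferential (Set.Ici 0) f b, ν ≤ g := by
  have slope : ∀ {t u : ℝ}, 0 ≤ t → t < b → b < u →
      (f b - f t) / (b - t) ≤ (f u - f b) / (u - b) := fun ht htb hbu =>
    hf.slope_mono_adjacent (Set.mem_Ici.2 ht) (Set.mem_Ici.2 (by linarith)) htb hbu
  set S := (fun t => (f b - f t) / (b - t)) '' Set.Ico 0 b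
  -- Any slope to the right of `b` dominates all slopes to the left; the supremum of the latter is
  -- the subgradient.
  have hbdd : BddAbove S := by
    refine ⟨(f (b + 1) - f b) / (b + 1 - b), ?_⟩
    rintro _ ⟨t, ht, rfl⟩
    exact slope ht.1 ht.2 (by linarith)
  have hmem : ∀ {t : ℝ}, 0 ≤ t → t < b → (f b - f t) / (b - t) ∈ S := fun ht htb =>
    ⟨_, ⟨ht, htb⟩, rfl⟩
  refine ⟨sSup S, fun t ht => ?_, ?_⟩
  · rcases lt_trichotomy t b with htb | rfl | hbt
    · have := le_csSup hbdd (hmem ht htb)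
      rw [div_le_iff₀ (by linarith)] at this
      linarith
    · simp
    · have : sSup S ≤ (f t - f b) / (t - b) := by
        refine csSup_le ⟨_, hmem ha hab⟩ ?_
        rintro _ ⟨u, hu, rfl⟩
        exact slope hu.1 hu.2 hbt
      rw [le_div_iff₀ (by linarith)] at this
      linarith
  · refine le_trans ?_ (le_csSup hbdd (hmem ha hab))
    rwa [le_div_iff₀ (by linarith)]

/-! ### Deterministic bounds on the empirical distance and the estimator. -/

section Feature

variable {X : Type*} {H : Type*} [NormedAddCommGroup H] [InnerProductSpace ℝ H]
  [CompleteSpace H] [RKHS ℝ H X ℝ]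

lemma inner_feature (f : H) (x : X) : ⟪f, feature H x⟫ = f x := by
  simp [feature]

lemma inner_feature_feature (x y : X) : ⟪feature H x, feature H y⟫ = kern H x y := by
  rw [real_inner_comm, inner_feature, feature, RKHS.kerFun_apply, kern]

lemma norm_feature_le (hk : ∀ x : X, kern H x x ≤ 1) (x : X) : ‖feature H x‖ ≤ 1 := by
  have h := hk x
  rw [← inner_feature_feature, real_inner_self_eq_norm_sq] at h
  exact (sq_le_one_iff₀ (norm_nonneg _)).1 h

lemma abs_apply_le (hk : ∀ x : X, kern H x x ≤ 1) (f : H) (x : X) : |f x| ≤ ‖f‖ := by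
  rw [← inner_feature]
  exact (abs_real_inner_le_norm _ _).trans
    (mul_le_of_le_one_right (norm_nonneg _) (norm_feature_le hk x))

lemma norm_feature_sub_le (hk : ∀ x : X, kern H x x ≤ 1) {c : H} (hc1 : ‖c‖ ≤ 1) (x : X) :
    ‖feature H x - c‖ ≤ 2 :=
  (norm_sub_le _ _).trans (by linarith [norm_feature_le hk x])

variable {n m : ℕ} (x : Fin n → X) (y : Fin m → X)

lemma dHat_nonneg (l : ℝ) : 0 ≤ dHat H x y l := Real.iInf_nonneg fun _ => norm_nonneg _

lemma dHat_le_norm {w : H} (hw : w ∈ sampleHull H x y) (l : ℝ) :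
    dHat H x y l ≤ ‖l • empMean H x + (1 - l) • empMean H y - w‖ :=
  ciInf_le (f := fun w : sampleHull H x y => ‖l • empMean H x + (1 - l) • empMean H y - (w : H)‖)
    ⟨0, by rintro _ ⟨w, rfl⟩; exact norm_nonneg _⟩ ⟨w, hw⟩

lemma sampleHull_nonempty (hn : 0 < n) : (sampleHull H x y).Nonempty :=
  ⟨_, _, single_mem_stdSimplex ℝ (Sum.inl ⟨0, hn⟩), rfl⟩

lemma convex_sampleHull : Convex ℝ (sampleHull H x y) := by
  rintro _ ⟨a, ha, rfl⟩ _ ⟨b, hb, rfl⟩ s t hs ht hst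
  refine ⟨_, convex_stdSimplex ℝ _ ha hb hs ht hst, ?_⟩
  simp [Finset.smul_sum, add_smul, smul_smul, Finset.sum_add_distrib]

/-- Partial minimisation over a convex set of a function jointly convex in `(l, w)`; near-minimisers
suffice, so attainment plays no role. -/
lemma convexOn_dHat (hn : 0 < n) (s : Set ℝ) (hs : Convex ℝ s) : ConvexOn ℝ s (dHat H x y) := by
  refine ⟨hs, fun l _ l' _ a b ha hb hab => le_of_forall_pos_le_add fun ε hε => ?_⟩
  have : Nonempty (sampleHull H x y) := (sampleHull_nonempty x y hn).to_subtype
  have approx : ∀ l, ∃ w ∈ sampleHull H x y,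
      ‖l • empMean H x + (1 - l) • empMean H y - w‖ < dHat H x y l + ε := fun l => by
    obtain ⟨w, hw⟩ := exists_lt_of_ciInf_lt (show dHat H x y l < dHat H x y l + ε by linarith)
    exact ⟨w, w.2, hw⟩
  obtain ⟨w, hw, h1⟩ := approx l
  obtain ⟨w', hw', h2⟩ := approx l'
  refine (dHat_le_norm x y (convex_sampleHull x y hw hw' ha hb hab) _).trans ?_
  have e : (a • l + b • l') • empMean H x + (1 - (a • l + b • l')) • empMean H y
      - (a • w + b • w') = a • (l • empMean H x + (1 - l) • empMean H y - w) +
        b • (l' • empMean H x + (1 - l') • empMean H y - w') := by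
    obtain rfl : b = 1 - a := by linarith
    simp only [smul_eq_mul]
    module
  rw [e]
  refine (norm_add_le _ _).trans ?_
  rw [norm_smul, norm_smul, Real.norm_of_nonneg ha, Real.norm_of_nonneg hb]
  simp only [smul_eq_mul]
  calc _ ≤ a * (dHat H x y l + ε) + b * (dHat H x y l' + ε) := by gcongr
    _ = a * dHat H x y l + b * dHat H x y l' + (a + b) * ε := by ring
    _ = _ := by rw [hab, one_mul]

lemma gradEstimator_le {ν l : ℝ} (hl : l ∈ gradThreshSet H x y ν) : gradEstimator H x y ν ≤ l :=
  csInf_le ⟨0, fun _ h => h.1⟩ hl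

lemma sub_gradEstimator_le {ν l A : ℝ} (hne : (gradThreshSet H x y ν).Nonempty) (hν : 0 < ν)
    (hl : 0 ≤ l) (hA : dHat H x y l ≤ A) : l - gradEstimator H x y ν ≤ A / ν := by
  have : l - A / ν ≤ gradEstimator H x y ν := by
    refine le_csInf hne ?_
    rintro t ⟨ht, g, hg, hνg⟩
    have hA0 : 0 ≤ A := (dHat_nonneg x y l).trans hA
    rcases le_total l t with h | h
    · have : 0 ≤ A / ν := by positivity
      linarith
    · have h1 := hg l hl
      have h2 := dHat_nonneg (H := H) x y t
      have h3 := mul_le_mul_of_nonneg_right hνg (sub_nonneg.2 h)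
      have : l - t ≤ A / ν := by rw [le_div_iff₀ hν]; linarith
      linarith
  linarith

variable {x y} {mF mG mH : H} {e lam : ℝ}

lemma dHat_le_of_embedding (hlam : 1 ≤ lam) (hmix : lam • mF + (1 - lam) • mH = mG)
    (hxF : ‖empMean H x - mF‖ ≤ e) (hyH : ‖empMean H y - mH‖ ≤ e) {w : H} {ρ : ℝ}
    (hw : w ∈ sampleHull H x y) (hwG : ‖mG - w‖ ≤ ρ) :
    dHat H x y lam ≤ (2 * lam - 1) * e + ρ := by
  refine (dHat_le_norm x y hw lam).trans ?_
  have h : lam • empMean H x + (1 - lam) • empMean H y - w =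
      lam • (empMean H x - mF) + (1 - lam) • (empMean H y - mH) + (mG - w) := by
    rw [← hmix]; module
  rw [h]
  refine (norm_add₃_le).trans ?_
  rw [norm_smul, norm_smul, Real.norm_of_nonneg (by linarith), Real.norm_eq_abs,
    abs_of_nonpos (by linarith)]
  have h1 := mul_le_mul_of_nonneg_left hxF (by linarith : 0 ≤ lam)
  have h2 := mul_le_mul_of_nonneg_left hyH (by linarith : 0 ≤ lam - 1)
  linarith

/-- Test the distance against `h`: hull points score at least `i`. With `q = l / lam`, the
population point is `q • mG + (1 - q) • mH`, which overshoots `mG` away from `mH` and scores at most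
`i + β - (q - 1) * α`. The sampling error costs `(2 * l - 1) * e`. -/
lemma le_dHat_of_separating (hn : 0 < n) (hlam : 1 ≤ lam)
    (hmix : lam • mF + (1 - lam) • mH = mG)
    (hxF : ‖empMean H x - mF‖ ≤ e) (hyH : ‖empMean H y - mH‖ ≤ e)
    {h : H} (hh : ‖h‖ ≤ 1) {i α β : ℝ} (hi : ∀ z, i ≤ h z) (hG : ⟪h, mG⟫ ≤ i + β)
    (hH : i + β ≤ ⟪h, mH⟫ - α) {l : ℝ} (hl : lam ≤ l) :
    (l / lam - 1) * α - β - (2 * l - 1) * e ≤ dHat H x y l := by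
  have : Nonempty (sampleHull H x y) := (sampleHull_nonempty x y hn).to_subtype
  refine le_ciInf ?_
  rintro ⟨_, a, ha, rfl⟩
  set w := ∑ j, a j • feature H (Sum.elim x y j)
  have hw : i ≤ ⟪h, w⟫ := by
    simp only [w, inner_sum, real_inner_smul_right, inner_feature]
    calc i = ∑ j, a j * i := by rw [← Finset.sum_mul, ha.2, one_mul]
      _ ≤ _ := Finset.sum_le_sum fun j _ => mul_le_mul_of_nonneg_left (hi _) (ha.1 j)
  have hinner : ∀ {u : H} {c : ℝ}, ‖u‖ ≤ c → ⟪h, u⟫ ≤ c := fun {u c} hu =>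
    (real_inner_le_norm h u).trans ((mul_le_of_le_one_left (norm_nonneg _) hh).trans hu)
  set p := l • empMean H x + (1 - l) • empMean H y
  have h1 : ⟪h, w⟫ - ⟪h, p⟫ ≤ ‖p - w‖ := by
    rw [← inner_sub_right]
    exact hinner (norm_sub_rev w p).le
  have hp : ⟪h, p⟫ = l * ⟪h, empMean H x - mF⟫ + (l - 1) * ⟪h, mH - empMean H y⟫ +
      (l * ⟪h, mF⟫ + (1 - l) * ⟪h, mH⟫) := by
    simp only [p, inner_add_right, inner_sub_right, real_inner_smul_right]
    ring
  have h2 := mul_le_mul_of_nonneg_left (hinner hxF) (by linarith : 0 ≤ l)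
  have h3 := mul_le_mul_of_nonneg_left (hinner ((norm_sub_rev _ _).trans_le hyH))
    (by linarith : 0 ≤ l - 1)
  have hlam0 : 0 < lam := by linarith
  have hF : ⟪h, mG⟫ = lam * ⟪h, mF⟫ + (1 - lam) * ⟪h, mH⟫ := by
    rw [← hmix, inner_add_right, real_inner_smul_right, real_inner_smul_right]
  set q := l / lam with hq
  have hlq : l = q * lam := by rw [hq]; field_simp
  have hq1 : 1 ≤ q := by rw [hq, one_le_div hlam0]; exact hl
  have h4 : l * ⟪h, mF⟫ + (1 - l) * ⟪h, mH⟫ = q * ⟪h, mG⟫ + (1 - q) * ⟪h, mH⟫ := by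
    rw [hF, hlq]; ring
  have h5 := mul_le_mul_of_nonneg_left hG (by linarith : 0 ≤ q)
  have h6 := mul_le_mul_of_nonneg_left hH (by linarith : 0 ≤ q - 1)
  linarith

end Feature

/-! ### Mean embeddings and concentration of weighted feature sums. -/

section Embedding

variable {X : Type*} [MeasurableSpace X] {H : Type*} [NormedAddCommGroup H]
  [InnerProductSpace ℝ H] [CompleteSpace H] [RKHS ℝ H X ℝ]

/-- Kernel sections span a dense subspace and norm convergence implies pointwise convergence, so
each element is a pointwise limit of measurable functions. -/
lemma measurable_apply (hk_meas : Measurable fun p : X × X => kern H p.1 p.2) (f : H) :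
    Measurable (f : X → ℝ) := by
  have hf : f ∈ closure (Submodule.span ℝ {RKHS.kerFun H x v | (x) (v)} : Set H) := by
    rw [← Submodule.topologicalClosure_coe, RKHS.kerFun_dense]
    trivial
  obtain ⟨u, hu, hlim⟩ := mem_closure_iff_seq_limit.1 hf
  refine measurable_of_tendsto_metrizable (f := fun k => (u k : X → ℝ)) (fun k => ?_) ?_
  · refine Submodule.span_induction (p := fun (g : H) _ => Measurable (g : X → ℝ)) ?_ ?_ ?_ ?_ (hu k)
    · rintro _ ⟨x, v, rfl⟩
      have h : (RKHS.kerFun H x v : X → ℝ) = fun y => v * kern H y x := by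
        funext y
        have hv : v = v • (1 : ℝ) := by simp
        rw [RKHS.kerFun_apply, kern, hv, map_smul]
        simp
      rw [h]
      exact (hk_meas.comp (measurable_id.prodMk measurable_const)).const_mul v
    · rw [RKHS.coe_zero]; exact measurable_zero
    · intro g g' _ _ hg hg'
      rw [RKHS.coe_add]; exact hg.add hg'
    · intro c g _ hg
      rw [RKHS.coe_smul]; exact hg.const_smul c
  · exact tendsto_pi_nhds.2 fun x => ((RKHS.continuous_eval x).tendsto f).comp hlim

lemma innerMeasurable_feature (hk_meas : Measurable fun p : X × X => kern H p.1 p.2) :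
    InnerMeasurable (feature H : X → H) where
  inner_left f := by
    simp_rw [inner_feature]
    exact measurable_apply hk_meas f
  inner_pair := by
    simp_rw [inner_feature_feature]
    exact hk_meas

variable {μ : Measure X} [IsProbabilityMeasure μ]

lemma integrable_apply (hk_meas : Measurable fun p : X × X => kern H p.1 p.2)
    (hk : ∀ x : X, kern H x x ≤ 1) (μ : Measure X)
    [IsProbabilityMeasure μ] (f : H) : Integrable (f : X → ℝ) μ :=
  Integrable.of_bound (measurable_apply hk_meas f).aestronglyMeasurable ‖f‖
    (Filter.Eventually.of_forall (abs_apply_le hk f))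

/-- The mean embedding of a probability measure, in the weak sense. -/
lemma exists_embedding (hk_meas : Measurable fun p : X × X => kern H p.1 p.2)
    (hk : ∀ x : X, kern H x x ≤ 1) (μ : Measure X)
    [IsProbabilityMeasure μ] :
    ∃ c : H, ‖c‖ ≤ 1 ∧ ∀ f : H, ⟪f, c⟫ = ∫ x, f x ∂μ := by
  let φ : H →ₗ[ℝ] ℝ :=
    { toFun := fun f => ∫ x, f x ∂μ
      map_add' := fun f g => by
        simp only [RKHS.coe_add, Pi.add_apply]
        exact integral_add (integrable_apply hk_meas hk μ f) (integrable_apply hk_meas hk μ g)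
      map_smul' := fun a f => by
        simp only [RKHS.coe_smul, Pi.smul_apply, smul_eq_mul, RingHom.id_apply]
        exact integral_const_mul _ _ }
  have hφ : ∀ f, ‖φ f‖ ≤ 1 * ‖f‖ := fun f => by
    have := norm_integral_le_of_norm_le_const (μ := μ)
      (f := fun x => f x) (C := ‖f‖) (Filter.Eventually.of_forall (abs_apply_le hk f))
    rw [one_mul]
    rw [probReal_univ, mul_one] at this
    exact this
  refine ⟨(InnerProductSpace.toDual ℝ H).symm (φ.mkContinuous 1 hφ), ?_, fun f => ?_⟩
  · rw [LinearIsometryEquiv.norm_map]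
    exact LinearMap.mkContinuous_norm_le _ zero_le_one _
  · rw [real_inner_comm, InnerProductSpace.toDual_symm_apply]
    rfl

lemma integral_norm_feature_sub_sq_le (hk_meas : Measurable fun p : X × X => kern H p.1 p.2)
    (hk : ∀ x : X, kern H x x ≤ 1)
    {c : H} (hc : ∀ f : H, ⟪f, c⟫ = ∫ x, f x ∂μ) :
    ∫ x, ‖feature H x - c‖ ^ 2 ∂μ ≤ 1 := by
  have hi : Integrable (fun x => c x) μ := integrable_apply hk_meas hk μ c
  have hpt : ∀ x, ‖feature H x - c‖ ^ 2 ≤ 1 - 2 * c x + ‖c‖ ^ 2 := fun x => by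
    rw [norm_sub_sq_real, real_inner_comm, inner_feature]
    have := norm_feature_le hk x
    have : ‖feature H x‖ ^ 2 ≤ 1 := pow_le_one₀ (norm_nonneg _) this
    linarith
  have hi1 : Integrable (fun x => 1 - 2 * c x) μ := (integrable_const _).sub (hi.const_mul 2)
  have hi2 : Integrable (fun x => 1 - 2 * c x + ‖c‖ ^ 2) μ := hi1.add (integrable_const _)
  calc _ ≤ ∫ x, (1 - 2 * c x + ‖c‖ ^ 2) ∂μ :=
        integral_mono_of_nonneg (Filter.Eventually.of_forall fun x => sq_nonneg _) hi2
          (Filter.Eventually.of_forall hpt)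
    _ = 1 - ‖c‖ ^ 2 := by
        rw [integral_add hi1 (integrable_const _), integral_sub (integrable_const _)
          (hi.const_mul 2), integral_const_mul, ← hc, real_inner_self_eq_norm_sq]
        simp
        ring
    _ ≤ 1 := by nlinarith [sq_nonneg ‖c‖]

/-- Concentration of the importance-weighted empirical embedding around the embedding `c` of the
target measure `ρ`, whose density with respect to the sampling measure `μ` is `r`. -/
lemma pi_norm_sum_smul_feature_sub_ge_le
    (hk_meas : Measurable fun p : X × X => kern H p.1 p.2)
    (hk : ∀ x : X, kern H x x ≤ 1) {ρ : Measure X} [IsProbabilityMeasure ρ] {r : X → ℝ}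
    (hr : Measurable r) (hr0 : ∀ x, 0 ≤ r x) {R : ℝ} (hR : 0 < R) (hrR : ∀ᵐ x ∂μ, r x ≤ R)
    (hrρ : ∀ f : X → ℝ, ∫ x, r x * f x ∂μ = ∫ x, f x ∂ρ)
    {c : H} (hc1 : ‖c‖ ≤ 1) (hc : ∀ f : H, ⟪f, c⟫ = ∫ x, f x ∂ρ)
    {ε : ℝ} (hε0 : 0 ≤ ε) (hε1 : ε ≤ 1) (n : ℕ) :
    Measure.pi (fun _ : Fin n => μ) {x | n * ε ≤ ‖∑ i, r (x i) • (feature H (x i) - c)‖} ≤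
      ENNReal.ofReal (2 * Real.exp (-(n * ε ^ 2 / (4 * R)))) := by
  have hφ : InnerMeasurable fun x : X => feature H x - c :=
    (innerMeasurable_feature hk_meas).sub_const c
  refine pi_norm_sum_ge_le (hφ.smul hr) (fun f => ?_) (b := R * 2) ?_ hR ?_ hε0
    (by nlinarith) n
  · simp_rw [real_inner_smul_right, hrρ, inner_sub_right, inner_feature]
    rw [integral_sub (integrable_apply hk_meas hk ρ f) (integrable_const _), hc]
    simp
  · filter_upwards [hrR] with x hx
    rw [norm_smul, Real.norm_of_nonneg (hr0 x)]
    have := norm_feature_sub_le hk hc1 x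
    gcongr
  · simp_rw [norm_smul, mul_pow, Real.norm_of_nonneg (hr0 _)]
    have hiφ : Integrable (fun x => R * (r x * ‖feature H x - c‖ ^ 2)) μ := by
      refine (Integrable.of_bound (hr.mul (hφ.norm.pow_const 2)).aestronglyMeasurable (R * 2 ^ 2)
        ?_).const_mul R
      filter_upwards [hrR] with x hx
      simp only [Pi.mul_apply]
      rw [Real.norm_of_nonneg (mul_nonneg (hr0 x) (sq_nonneg _))]
      have := norm_feature_sub_le hk hc1 x
      gcongr
    -- Trading one factor `r ≤ R` for the change of measure keeps the variance linear in `R` rather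
    -- than quadratic.
    calc _ ≤ ∫ x, R * (r x * ‖feature H x - c‖ ^ 2) ∂μ := by
          refine integral_mono_of_nonneg (Filter.Eventually.of_forall fun x => by positivity) hiφ ?_
          filter_upwards [hrR] with x hx
          rw [sq (r x), mul_assoc]
          exact mul_le_mul_of_nonneg_right hx (mul_nonneg (hr0 x) (sq_nonneg _))
      _ ≤ R := by
          rw [integral_const_mul, hrρ]
          exact mul_le_of_le_one_right hR.le (integral_norm_feature_sub_sq_le hk_meas hk hc)

end Embedding

/-! ### Bounded densities as importance weights. -/

section Weights

variable {X : Type*} [MeasurableSpace X] {μ ρ : Measure X} [IsProbabilityMeasure μ]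
  [IsProbabilityMeasure ρ]

/-- Concentration of the total importance weight. -/
lemma pi_abs_sum_sub_one_ge_le {r : X → ℝ} (hr : Measurable r) (hr0 : ∀ x, 0 ≤ r x) {R : ℝ}
    (hR : 1 ≤ R) (hrR : ∀ᵐ x ∂μ, r x ≤ R)
    (hrρ : ∀ f : X → ℝ, ∫ x, r x * f x ∂μ = ∫ x, f x ∂ρ) (n : ℕ) :
    Measure.pi (fun _ : Fin n => μ) {x | n * (1 / 4) ≤ |∑ i, (r (x i) - 1)|} ≤
      ENNReal.ofReal (2 * Real.exp (-(n * (1 / 4) ^ 2 / (4 * R)))) := by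
  have hr1 : ∫ x, r x ∂μ = 1 := by simpa using hrρ fun _ => 1
  have hi : Integrable r μ := by
    refine Integrable.of_bound hr.aestronglyMeasurable R ?_
    filter_upwards [hrR] with x hx
    rwa [Real.norm_of_nonneg (hr0 x)]
  refine pi_norm_sum_ge_le (H := ℝ) (InnerMeasurable.of_real (hr.sub_const 1)) (fun f => ?_)
    (b := R) ?_ (by linarith) ?_ (by norm_num) (by linarith) n
  · simp only [RCLike.inner_apply, conj_trivial]
    rw [integral_mul_const, integral_sub hi (integrable_const _), hr1]
    simp
  · filter_upwards [hrR] with x hx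
    have := hr0 x
    rw [Real.norm_eq_abs, abs_le]
    constructor <;> linarith
  · have hi2 : Integrable (fun x => (R - 2) * r x + 1) μ :=
      (hi.const_mul _).add (integrable_const _)
    -- Expand `(r - 1) ^ 2` and use `r ^ 2 ≤ R * r`.
    calc _ ≤ ∫ x, ((R - 2) * r x + 1) ∂μ := by
          refine integral_mono_of_nonneg (Filter.Eventually.of_forall fun x => by positivity) hi2 ?_
          filter_upwards [hrR] with x hx
          simp only [Real.norm_eq_abs, sq_abs]
          nlinarith [mul_le_mul_of_nonneg_right hx (hr0 x)]
      _ ≤ R := by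
          rw [integral_add (hi.const_mul _) (integrable_const _), integral_const_mul, hr1]
          simp only [integral_const, probReal_univ, one_smul]
          linarith

/-- A probability measure dominated by `R • μ` has a density bounded by `R`. -/
lemma exists_bounded_density {R : ℝ} (hR : 0 < R) (h : ENNReal.ofReal R⁻¹ • ρ ≤ μ) :
    ∃ r : X → ℝ, Measurable r ∧ (∀ x, 0 ≤ r x) ∧ (∀ᵐ x ∂μ, r x ≤ R) ∧
      ∀ f : X → ℝ, ∫ x, r x * f x ∂μ = ∫ x, f x ∂ρ := by
  have hR' : 0 < R⁻¹ := inv_pos.2 hR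
  have hac : ρ ≪ μ := (Measure.absolutelyContinuous_smul (by simpa using hR)).trans
    (Measure.absolutelyContinuous_of_le h)
  refine ⟨fun x => (ρ.rnDeriv μ x).toReal, (Measure.measurable_rnDeriv ρ μ).ennreal_toReal,
    fun x => ENNReal.toReal_nonneg, ?_, fun f => ?_⟩
  · filter_upwards [Measure.rnDeriv_le_one_of_le h,
      Measure.rnDeriv_smul_left_of_ne_top ρ μ (r := ENNReal.ofReal R⁻¹) ENNReal.ofReal_ne_top]
      with x h1 h2
    rw [h2] at h1
    have h3 := ENNReal.toReal_mono ENNReal.one_ne_top h1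
    simp only [Pi.smul_apply, smul_eq_mul, ENNReal.toReal_mul, ENNReal.toReal_one] at h3
    rw [ENNReal.toReal_ofReal hR'.le, inv_mul_le_iff₀ hR, mul_one] at h3
    exact h3
  · simpa using integral_rnDeriv_smul (f := f) hac

end Weights

/-! ### High-probability events for the samples. -/

/-- The law of an i.i.d. sample transfers tail bounds from the product measure. -/
lemma exists_measurable_event {Ω X : Type*} [MeasurableSpace Ω] [MeasurableSpace X]
    {P : Measure Ω} [IsProbabilityMeasure P] {μ : Measure X} {n : ℕ} {x : Fin n → Ω → X}
    (hx : ∀ i, HasLaw (x i) μ P) (hindep : iIndepFun x P) {S : Set (Fin n → X)}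
    {δ : ℝ}
    (h : Measure.pi (fun _ : Fin n => μ) S ≤ ENNReal.ofReal δ) :
    ∃ B : Set Ω, MeasurableSet B ∧ P B ≤ ENNReal.ofReal δ ∧
      ∀ ω, ω ∉ B → (fun i => x i ω) ∉ S := by
  have hmap := (iIndepFun_iff_map_fun_eq_pi_map fun i => (hx i).aemeasurable).1 hindep
  simp_rw [(hx _).map_eq] at hmap
  have hae : AEMeasurable (fun ω i => x i ω) P :=
    aemeasurable_pi_lambda _ fun i => (hx i).aemeasurable
  refine ⟨toMeasurable P ((fun ω i => x i ω) ⁻¹' S), measurableSet_toMeasurable _ _, ?_,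
    fun ω hω hS => hω (subset_toMeasurable _ _ hS)⟩
  rw [measure_toMeasurable]
  exact (Measure.le_map_apply hae S).trans (hmap ▸ h)

lemma two_mul_exp_neg_le {δ a : ℝ} (hδ0 : 0 < δ) (hδ1 : δ ≤ 1 / 4)
    (ha : 9 / 4 * Real.log (1 / δ) ≤ a) : 2 * Real.exp (-a) ≤ δ := by
  set ℓ := Real.log (1 / δ) with hℓ
  have h4 : Real.log 4 ≤ ℓ := Real.log_le_log (by norm_num) (by
    rw [le_div_iff₀ hδ0]; linarith)
  have h2 : Real.log 4 = 2 * Real.log 2 := by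
    rw [show (4 : ℝ) = 2 ^ 2 by norm_num, Real.log_pow]; norm_num
  have h20 := Real.log_pos (show (1 : ℝ) < 2 by norm_num)
  calc 2 * Real.exp (-a) ≤ 2 * Real.exp (-Real.log 2 + -ℓ) := by
        gcongr; linarith
    _ = δ := by
        rw [Real.exp_add, Real.exp_neg, Real.exp_neg, Real.exp_log (by norm_num), hℓ,
          Real.exp_log (by positivity)]
        simp

section Events

variable {X : Type*} [MeasurableSpace X] {H : Type*} [NormedAddCommGroup H]
  [InnerProductSpace ℝ H] [CompleteSpace H] [RKHS ℝ H X ℝ]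
  {Ω : Type*} [MeasurableSpace Ω] {P : Measure Ω} [IsProbabilityMeasure P]
  {μ : Measure X} [IsProbabilityMeasure μ] {n : ℕ} {x : Fin n → Ω → X}

lemma exists_event_norm_sum_smul_lt
    (hk_meas : Measurable fun p : X × X => kern H p.1 p.2) (hk : ∀ x : X, kern H x x ≤ 1)
    (hx : ∀ i, HasLaw (x i) μ P) (hindep : iIndepFun x P)
    {ρ : Measure X} [IsProbabilityMeasure ρ] {r : X → ℝ}
    (hr : Measurable r) (hr0 : ∀ x, 0 ≤ r x) {R : ℝ} (hR : 0 < R) (hrR : ∀ᵐ x ∂μ, r x ≤ R)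
    (hrρ : ∀ f : X → ℝ, ∫ x, r x * f x ∂μ = ∫ x, f x ∂ρ)
    {c : H} (hc1 : ‖c‖ ≤ 1) (hc : ∀ f : H, ⟪f, c⟫ = ∫ x, f x ∂ρ)
    {δ : ℝ} (hδ0 : 0 < δ) (hδ1 : δ ≤ 1 / 4) (hn : 0 < n)
    (hnR : 3 * √R * √(Real.log (1 / δ)) ≤ √n) :
    ∃ B : Set Ω, MeasurableSet B ∧ P B ≤ ENNReal.ofReal δ ∧ ∀ ω, ω ∉ B →
      ‖∑ i, r (x i ω) • (feature H (x i ω) - c)‖ <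
        n * (3 * √R * √(Real.log (1 / δ)) / √n) := by
  have hn' : (0 : ℝ) < n := Nat.cast_pos.2 hn
  have hlog : 0 ≤ Real.log (1 / δ) := Real.log_nonneg (by rw [le_div_iff₀ hδ0]; linarith)
  -- This `ε` makes the exponent `n * ε ^ 2 / (4 * R)` equal to `9 / 4 * log (1 / δ)`.
  have htail := pi_norm_sum_smul_feature_sub_ge_le hk_meas hk hr hr0 hR hrR hrρ hc1 hc
    (ε := 3 * √R * √(Real.log (1 / δ)) / √n) (by positivity)
    (by rwa [div_le_one (Real.sqrt_pos.2 hn')]) n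
  obtain ⟨B, hB, hPB, hBS⟩ := exists_measurable_event hx hindep (htail.trans
    (ENNReal.ofReal_le_ofReal (two_mul_exp_neg_le hδ0 hδ1 (le_of_eq (by
      rw [div_pow, mul_pow, mul_pow, Real.sq_sqrt hR.le, Real.sq_sqrt hlog,
        Real.sq_sqrt hn'.le]
      field_simp
      ring)))))
  exact ⟨B, hB, hPB, fun ω hω => not_le.1 (hBS ω hω)⟩

/-- Concentration of the empirical mean embedding. -/
lemma exists_event_norm_empMean_sub_le
    (hk_meas : Measurable fun p : X × X => kern H p.1 p.2) (hk : ∀ x : X, kern H x x ≤ 1)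
    (hx : ∀ i, HasLaw (x i) μ P) (hindep : iIndepFun x P)
    {c : H} (hc1 : ‖c‖ ≤ 1) (hc : ∀ f : H, ⟪f, c⟫ = ∫ x, f x ∂μ)
    {δ : ℝ} (hδ0 : 0 < δ) (hδ1 : δ ≤ 1 / 4) (hn : 0 < n)
    (hnR : 3 * √(Real.log (1 / δ)) ≤ √n) :
    ∃ B : Set Ω, MeasurableSet B ∧ P B ≤ ENNReal.ofReal δ ∧ ∀ ω, ω ∉ B →
      ‖empMean H (fun i => x i ω) - c‖ ≤ 3 * √(Real.log (1 / δ)) / √n := by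
  have hn' : (0 : ℝ) < n := Nat.cast_pos.2 hn
  obtain ⟨B, hB, hPB, h⟩ := exists_event_norm_sum_smul_lt hk_meas hk hx hindep
    (r := fun _ => 1) measurable_const (fun _ => zero_le_one) one_pos
    (Filter.Eventually.of_forall fun _ => le_rfl) (fun f => by simp) hc1 hc hδ0 hδ1 hn
    (by rwa [Real.sqrt_one, mul_one])
  refine ⟨B, hB, hPB, fun ω hω => ?_⟩
  have h1 := (h ω hω).le
  rw [Real.sqrt_one, mul_one] at h1
  have e : empMean H (fun i => x i ω) - c =
      (n : ℝ)⁻¹ • ∑ i, (1 : ℝ) • (feature H (x i ω) - c) := by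
    simp only [one_smul, Finset.sum_sub_distrib, Finset.sum_const, Finset.card_univ,
      Fintype.card_fin, smul_sub, empMean]
    rw [← Nat.cast_smul_eq_nsmul ℝ, inv_smul_smul₀ hn'.ne']
  rw [e, norm_smul, Real.norm_of_nonneg (by positivity), inv_mul_le_iff₀ hn']
  exact h1

/-- If `ρ` has a density bounded by `R` with respect to the sampling distribution, then the
embedding of `ρ` is close to the convex hull of the embedded sample. -/
lemma exists_event_dist_sampleHull_le
    (hk_meas : Measurable fun p : X × X => kern H p.1 p.2) (hk : ∀ x : X, kern H x x ≤ 1)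
    (hx : ∀ i, HasLaw (x i) μ P) (hindep : iIndepFun x P)
    {ρ : Measure X} [IsProbabilityMeasure ρ] {R : ℝ} (hR : 1 ≤ R)
    (hρμ : ENNReal.ofReal R⁻¹ • ρ ≤ μ)
    {c : H} (hc1 : ‖c‖ ≤ 1) (hc : ∀ f : H, ⟪f, c⟫ = ∫ x, f x ∂ρ)
    {δ : ℝ} (hδ0 : 0 < δ) (hδ1 : δ ≤ 1 / 4) (hn : 0 < n)
    (hnR : 24 * R * √(Real.log (1 / δ)) ≤ √n) :
    ∃ B : Set Ω, MeasurableSet B ∧ P B ≤ ENNReal.ofReal (2 * δ) ∧ ∀ ω, ω ∉ B →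
      ∀ {m : ℕ} (y : Fin m → X), ∃ w ∈ sampleHull H (fun i => x i ω) y,
        ‖c - w‖ ≤ √(2 * R) * (3 * √(Real.log (1 / δ)) / √n) := by
  have hn' : (0 : ℝ) < n := Nat.cast_pos.2 hn
  have hR0 : 0 < R := by linarith
  have hlog : 0 ≤ Real.log (1 / δ) := Real.log_nonneg (by rw [le_div_iff₀ hδ0]; linarith)
  set L := √(Real.log (1 / δ)) with hL
  have hL0 : 0 ≤ L := Real.sqrt_nonneg _
  obtain ⟨r, hr, hr0, hrR, hrρ⟩ := exists_bounded_density hR0 hρμ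
  have hsR : √R ≤ R := Real.sqrt_le_iff.2 ⟨hR0.le, by nlinarith⟩
  obtain ⟨B₁, hB₁, hPB₁, h₁⟩ := exists_event_norm_sum_smul_lt hk_meas hk hx hindep hr hr0 hR0
    hrR hrρ hc1 hc hδ0 hδ1 hn (by
      refine le_trans ?_ hnR
      rw [← hL]
      have := mul_le_mul_of_nonneg_right hsR hL0
      have := mul_nonneg hR0.le hL0
      nlinarith)
  have hnR2 : 576 * R * Real.log (1 / δ) ≤ n := by
    have h := pow_le_pow_left₀ (by positivity) hnR 2
    rw [Real.sq_sqrt hn'.le, mul_pow, mul_pow, hL, Real.sq_sqrt hlog] at h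
    refine le_trans ?_ h
    have := mul_nonneg (mul_nonneg hR0.le (sub_nonneg.2 hR)) hlog
    nlinarith
  obtain ⟨B₂, hB₂, hPB₂, h₂⟩ := exists_measurable_event hx hindep
    ((pi_abs_sum_sub_one_ge_le hr hr0 hR hrR hrρ n).trans
      (ENNReal.ofReal_le_ofReal (two_mul_exp_neg_le hδ0 hδ1 (by
        rw [le_div_iff₀ (by positivity)]
        nlinarith))))
  refine ⟨B₁ ∪ B₂, hB₁.union hB₂, ?_, fun ω hω m y => ?_⟩
  · refine (measure_union_le _ _).trans ((add_le_add hPB₁ hPB₂).trans_eq ?_)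
    rw [← ENNReal.ofReal_add hδ0.le hδ0.le, two_mul]
  · rw [Set.mem_union, not_or] at hω
    have g₁ := h₁ ω hω.1
    have g₂ : |∑ i, (r (x i ω) - 1)| < n * (1 / 4) := not_le.1 (h₂ ω hω.2)
    rw [← hL] at g₁
    set S := ∑ i, r (x i ω) with hS
    have hS34 : 3 / 4 * n ≤ S := by
      simp only [Finset.sum_sub_distrib, Finset.sum_const, Finset.card_univ, Fintype.card_fin,
        nsmul_eq_mul, mul_one, ← hS] at g₂
      have := (abs_lt.1 g₂).1
      linarith
    have hS0 : 0 < S := by nlinarith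
    -- Self-normalised importance weights on the first sample, none on the second. Centering each
    -- feature at `c` lets the random normalisation factor out exactly.
    refine ⟨∑ j, Sum.elim (fun i => S⁻¹ * r (x i ω)) (fun _ : Fin m => 0) j •
      feature H (Sum.elim (fun i => x i ω) y j), ⟨_, ⟨?_, ?_⟩, rfl⟩, ?_⟩
    · rintro (i | j)
      · exact mul_nonneg (inv_nonneg.2 hS0.le) (hr0 _)
      · exact le_rfl
    · simp [Fintype.sum_sum_type, ← Finset.mul_sum, ← hS, hS0.ne']
    · have e : c - ∑ j, Sum.elim (fun i => S⁻¹ * r (x i ω)) (fun _ : Fin m => 0) j •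
          feature H (Sum.elim (fun i => x i ω) y j) =
          -(S⁻¹ • ∑ i, r (x i ω) • (feature H (x i ω) - c)) := by
        simp only [Fintype.sum_sum_type, Sum.elim_inl, Sum.elim_inr, zero_smul,
          Finset.sum_const_zero, add_zero, smul_sub, Finset.sum_sub_distrib, ← Finset.sum_smul,
          ← hS, inv_smul_smul₀ hS0.ne', neg_sub, Finset.smul_sum, smul_smul]
      rw [e, norm_neg, norm_smul, Real.norm_of_nonneg (by positivity), inv_mul_le_iff₀ hS0]
      refine g₁.le.trans ?_
      -- The total weight is at least `3 / 4 * n`, so normalising costs at most `4 / 3 ≤ √2`; this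
      -- turns `√R` into `√(2 * R)`.
      have h2 : 4 / 3 ≤ √2 := Real.le_sqrt_of_sq_le (by norm_num)
      rw [Real.sqrt_mul (by norm_num)]
      have hSn : (n : ℝ) ≤ S * √2 := by nlinarith
      calc (n : ℝ) * (3 * √R * L / √n) ≤ S * √2 * (3 * √R * L / √n) := by gcongr
        _ = _ := by ring

end Events

/-! ### The choice of the overshoot. -/

lemma threshold_numeric {lam α β ν e : ℝ} (hlam : 1 ≤ lam) (hα : 0 < α) (hβ : 0 ≤ β)
    (he : 0 ≤ e) (hν : ν ≤ 3 * α / (4 * lam)) (hes : 12 * e ≤ α / lam - ν) :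
    β + (4 * lam - 2 + √(2 * lam)) * e ≤
      (4 * β * lam / α + 48 * lam ^ 2 * (α + 4 * β) / α ^ 2 * e) * (α / lam - ν - 2 * e) := by
  have hlam0 : 0 < lam := by linarith
  have hs : α / (4 * lam) ≤ α / lam - ν := by
    have : α / lam = α / (4 * lam) + 3 * α / (4 * lam) := by field_simp; norm_num
    linarith
  set s := α / lam - ν
  have hsq : √(2 * lam) ≤ 2 * lam := Real.sqrt_le_iff.2 ⟨by linarith, by nlinarith⟩
  have h1 : β ≤ 4 * β * lam / α * s :=
    calc β = 4 * β * lam / α * (α / (4 * lam)) := by field_simp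
      _ ≤ _ := by gcongr
  -- As `12 * e ≤ s`, at least `5 / 6` of `s ≥ α / (4 * lam)` survives, and `48 * (5 / 6) / 4 = 10`.
  -- The surplus `40 * lam * β / α * e` pays for the cross term `8 * lam * β / α * e` in `h3`.
  have h2 : 10 * lam * e + 40 * lam * β / α * e ≤
      48 * lam ^ 2 * (α + 4 * β) / α ^ 2 * e * (s - 2 * e) :=
    calc _ = 48 * lam ^ 2 * (α + 4 * β) / α ^ 2 * e * (5 / 6 * (α / (4 * lam))) := by
          field_simp; ring
      _ ≤ _ := by gcongr; linarith
  have h3 : 4 * β * lam / α * (2 * e) = 8 * lam * β / α * e := by ring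
  have h4 : 0 ≤ lam * β / α * e := by positivity
  have h5 : (4 * lam - 2 + √(2 * lam)) * e ≤ 10 * lam * e := by gcongr; linarith
  have h6 : 40 * lam * β / α * e = 40 * (lam * β / α * e) := by ring
  have h7 : 8 * lam * β / α * e = 8 * (lam * β / α * e) := by ring
  linarith

end MPE

end

/-! ### The main theorem. -/

theorem theorem4 {X : Type*} [MetricSpace X] [CompactSpace X] [MeasurableSpace X] [BorelSpace X]
    {H : Type*} [NormedAddCommGroup H] [InnerProductSpace ℝ H] [CompleteSpace H] [RKHS ℝ H X ℝ]
    (hk_meas : Measurable fun p : X × X => MPE.kern H p.1 p.2)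
    (hk : ∀ x : X, MPE.kern H x x ≤ 1)
    (F G Hd : Measure X) [IsProbabilityMeasure F] [IsProbabilityMeasure G]
    [IsProbabilityMeasure Hd]
    (κ lam : ℝ) (hκ0 : 0 ≤ κ) (hκ1 : κ < 1) (hlam : lam = 1 / (1 - κ))
    (hF : F = ENNReal.ofReal (1 - κ) • G + ENNReal.ofReal κ • Hd)
    (α β : ℝ) (hα : 0 < α) (hsep : MPE.Separable H G Hd α β)
    (δ : ℝ) (hδ0 : 0 < δ) (hδ1 : δ ≤ 1 / 4)
    (ν : ℝ) (hν0 : α / (4 * lam) ≤ ν) (hν1 : ν ≤ 3 * α / (4 * lam))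
    (n m : ℕ)
    (hnm : 36 * √(Real.log (1 / δ)) / (α / lam - ν) ≤ √((min m n : ℕ) : ℝ))
    {Ω : Type*} [MeasurableSpace Ω] (P : Measure Ω) [IsProbabilityMeasure P]
    (x : Fin n → Ω → X) (y : Fin m → Ω → X)
    (hx : ∀ i, HasLaw (x i) F P) (hy : ∀ j, HasLaw (y j) Hd P)
    (hindep : iIndepFun (Sum.elim x y) P) :
    ∃ E : Set Ω, MeasurableSet E ∧ ENNReal.ofReal (1 - 4 * δ) ≤ P E ∧
      ∀ ω ∈ E,
        (MPE.gradThreshSet H (fun i => x i ω) (fun j => y j ω) ν).Nonempty ∧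
        lam - MPE.gradEstimator H (fun i => x i ω) (fun j => y j ω) ν
          ≤ (2 * lam - 1 + √(2 * lam)) * (12 * lam / α)
            * √(Real.log (1 / δ)) * ((min m n : ℕ) : ℝ) ^ (-(1 / 2) : ℝ) ∧
        MPE.gradEstimator H (fun i => x i ω) (fun j => y j ω) ν - lam
          ≤ 4 * β * lam / α
            + 144 * lam ^ 2 * (α + 4 * β) / α ^ 2
              * √(Real.log (1 / δ)) * ((min m n : ℕ) : ℝ) ^ (-(1 / 2) : ℝ) := by
  obtain ⟨h, hh1, hG, hH⟩ := hsep
  obtain ⟨mF, hmF1, hmF⟩ := MPE.exists_embedding hk_meas hk F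
  obtain ⟨mG, hmG1, hmG⟩ := MPE.exists_embedding hk_meas hk G
  obtain ⟨mH, hmH1, hmH⟩ := MPE.exists_embedding hk_meas hk Hd
  have hκ : 0 < 1 - κ := by linarith
  have hlam0 : 0 < lam := hlam ▸ one_div_pos.2 hκ
  have hlam1 : 1 ≤ lam := by rw [hlam, le_div_iff₀ hκ]; linarith
  have hlaminv : lam⁻¹ = 1 - κ := by rw [hlam, one_div, inv_inv]
  have hmix : lam • mF + (1 - lam) • mH = mG := by
    refine ext_inner_left ℝ fun f => ?_
    have hint := fun (μ : Measure X) [IsProbabilityMeasure μ] =>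
      MPE.integrable_apply hk_meas hk μ f
    have hFf : ∫ x, f x ∂F = (1 - κ) * ∫ x, f x ∂G + κ * ∫ x, f x ∂Hd := by
      rw [hF, integral_add_measure ((hint G).smul_measure ENNReal.ofReal_ne_top)
        ((hint Hd).smul_measure ENNReal.ofReal_ne_top), integral_smul_measure,
        integral_smul_measure, ENNReal.toReal_ofReal hκ.le, ENNReal.toReal_ofReal hκ0]
      rfl
    rw [inner_add_right, real_inner_smul_right, real_inner_smul_right, hmF, hmG, hmH, hFf, hlam]
    field_simp
    ring
  have hdom : ENNReal.ofReal lam⁻¹ • G ≤ F := by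
    rw [hF, hlaminv]
    exact Measure.le_add_right le_rfl
  have habs : ∀ z, |h z| ≤ 1 := fun z => (MPE.abs_apply_le hk h z).trans hh1
  have hi : ∀ z, (⨅ z, h z) ≤ h z := fun z =>
    ciInf_le ⟨-1, by rintro _ ⟨z, rfl⟩; exact (abs_le.1 (habs z)).1⟩ z
  rw [← hmG h] at hG
  rw [← hmH h] at hH
  set i := ⨅ z, h z
  have hβ : 0 ≤ β := by
    have : i ≤ ∫ z, h z ∂G := by
      have := integral_mono (μ := G) (integrable_const i)
        (MPE.integrable_apply hk_meas hk G h) hi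
      simpa using this
    rw [← hmG h] at this
    linarith
  -- The margin separates two values of `h` in `[-1, 1]`. This bounds `α / lam - ν` by `3 / (2 *
  -- lam)`, so the constant 36 yields the sample size `24 * lam * L ≤ √N` needed for the hull event.
  have hα2 : α ≤ 2 := by
    have key : ∀ c : H, ‖c‖ ≤ 1 → |inner ℝ h c| ≤ 1 := fun c hc =>
      (abs_real_inner_le_norm h c).trans (mul_le_one₀ hh1 (norm_nonneg _) hc)
    have h1 := (abs_le.1 (key mG hmG1)).1
    have h2 := (abs_le.1 (key mH hmH1)).2
    linarith
  have hlog : 0 < Real.log (1 / δ) := Real.log_pos (by rw [lt_div_iff₀ hδ0]; linarith)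
  set L := √(Real.log (1 / δ)) with hL
  have hL0 : 0 < L := Real.sqrt_pos.2 hlog
  have hs0 : 0 < α / lam - ν := by
    have h1 : α / lam = α / (4 * lam) + 3 * α / (4 * lam) := by field_simp; norm_num
    have h2 : 0 < α / (4 * lam) := by positivity
    linarith
  have hN : 0 < √((min m n : ℕ) : ℝ) := lt_of_lt_of_le (by positivity) hnm
  set N := min m n with hNdef
  have hsle : α / lam - ν ≤ 3 / (2 * lam) := by
    have h1 : α / lam = α / (4 * lam) + 3 * α / (4 * lam) := by field_simp; norm_num
    have h2 : α / lam - α / (4 * lam) ≤ 3 / (2 * lam) := by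
      rw [h1, add_sub_cancel_left, div_le_div_iff₀ (by positivity) (by positivity)]
      nlinarith
    linarith
  have hNL : 36 * L ≤ √(N : ℝ) * (α / lam - ν) := by rwa [div_le_iff₀ hs0] at hnm
  have hN24 : 24 * lam * L ≤ √(N : ℝ) := by
    have h1 := hNL.trans (mul_le_mul_of_nonneg_left hsle hN.le)
    rw [mul_div_assoc', le_div_iff₀ (by positivity)] at h1
    linarith
  have hNm : √(N : ℝ) ≤ √(m : ℝ) := Real.sqrt_le_sqrt (Nat.cast_le.2 (min_le_left _ _))
  have hNn : √(N : ℝ) ≤ √(n : ℝ) := Real.sqrt_le_sqrt (Nat.cast_le.2 (min_le_right _ _))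
  have hm0 : 0 < m := Nat.cast_pos.1 (Real.sqrt_pos.1 (hN.trans_le hNm))
  have hn0 : 0 < n := Nat.cast_pos.1 (Real.sqrt_pos.1 (hN.trans_le hNn))
  have h3L : 3 * L ≤ √(N : ℝ) := le_trans (by nlinarith) hN24
  have hxi : iIndepFun x P := hindep.precomp (g := Sum.inl) Sum.inl_injective
  have hyi : iIndepFun y P := hindep.precomp (g := Sum.inr) Sum.inr_injective
  obtain ⟨B₁, hB₁, hPB₁, h₁⟩ := MPE.exists_event_norm_empMean_sub_le hk_meas hk hx hxi hmF1 hmF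
    hδ0 hδ1 hn0 (h3L.trans hNn)
  obtain ⟨B₂, hB₂, hPB₂, h₂⟩ := MPE.exists_event_norm_empMean_sub_le hk_meas hk hy hyi hmH1 hmH
    hδ0 hδ1 hm0 (h3L.trans hNm)
  obtain ⟨B₃, hB₃, hPB₃, h₃⟩ := MPE.exists_event_dist_sampleHull_le hk_meas hk hx hxi hlam1
    hdom hmG1 hmG hδ0 hδ1 hn0 (hN24.trans hNn)
  rw [← hL] at h₁ h₂ h₃
  refine ⟨(B₁ ∪ B₂ ∪ B₃)ᶜ, ((hB₁.union hB₂).union hB₃).compl, ?_, fun ω hω => ?_⟩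
  · rw [prob_compl_eq_one_sub ((hB₁.union hB₂).union hB₃), ENNReal.ofReal_sub _ (by positivity),
      ENNReal.ofReal_one]
    refine tsub_le_tsub_left ?_ _
    calc P (B₁ ∪ B₂ ∪ B₃) ≤ P B₁ + P B₂ + P B₃ :=
          (measure_union_le _ _).trans (by gcongr; exact measure_union_le _ _)
      _ ≤ ENNReal.ofReal δ + ENNReal.ofReal δ + ENNReal.ofReal (2 * δ) := by gcongr
      _ = ENNReal.ofReal (4 * δ) := by
          rw [← ENNReal.ofReal_add hδ0.le hδ0.le, ← ENNReal.ofReal_add (by positivity)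
            (by positivity)]
          congr 1
          ring
  simp only [Set.mem_compl_iff, Set.mem_union, not_or] at hω
  obtain ⟨⟨hω₁, hω₂⟩, hω₃⟩ := hω
  set e := 3 * L / √(N : ℝ) with he
  have he0 : 0 < e := by positivity
  have hes : 12 * e ≤ α / lam - ν := by
    rw [he, mul_div_assoc', div_le_iff₀ hN]
    linarith
  have hrpow : (N : ℝ) ^ (-(1 / 2) : ℝ) = (√(N : ℝ))⁻¹ := by
    rw [Real.rpow_neg (Nat.cast_nonneg _), Real.sqrt_eq_rpow]
  have hxF := (h₁ ω hω₁).trans (show _ ≤ e by rw [he]; gcongr)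
  have hyH := (h₂ ω hω₂).trans (show _ ≤ e by rw [he]; gcongr)
  obtain ⟨w, hw, hwG⟩ := h₃ ω hω₃ (fun j => y j ω)
  replace hwG := hwG.trans (show _ ≤ √(2 * lam) * e by rw [he]; gcongr)
  have hupper := MPE.dHat_le_of_embedding hlam1 hmix hxF hyH hw hwG
  -- The overshoot: slope at least `ν` on `[lam, lam + D]` amounts to `β + (4 * lam - 2 + √(2 *
  -- lam)) * e ≤ D * (α / lam - ν - 2 * e)`. Since `e = 3 * L / √N`, the 48 becomes the 144 of the
  -- statement.
  set D := 4 * β * lam / α + 48 * lam ^ 2 * (α + 4 * β) / α ^ 2 * e with hD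
  have hD0 : 0 < D := by positivity
  have hlower := MPE.le_dHat_of_separating hn0 hlam1 hmix hxF hyH hh1 hi hG hH
    (l := lam + D) (by linarith)
  have hnum := MPE.threshold_numeric hlam1 hα hβ he0.le hν1 hes
  rw [← hD] at hnum
  have hsplit : ((lam + D) / lam - 1) * α = D * (α / lam) := by field_simp; ring
  rw [hsplit] at hlower
  have hmem : lam + D ∈ MPE.gradThreshSet H (fun i => x i ω) (fun j => y j ω) ν :=
    ⟨by positivity, MPE.exists_subgradient_ge
      (MPE.convexOn_dHat _ _ hn0 _ (convex_Ici 0)) hlam0.le (by linarith) (by linarith)⟩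
  have hν : 0 < ν := lt_of_lt_of_le (by positivity) hν0
  refine ⟨⟨_, hmem⟩, ?_, ?_⟩
  · refine (MPE.sub_gradEstimator_le _ _ ⟨_, hmem⟩ hν hlam0.le hupper).trans ?_
    have h0 : 0 ≤ (2 * lam - 1) * e + √(2 * lam) * e :=
      add_nonneg (mul_nonneg (by linarith) he0.le) (by positivity)
    -- Dividing by `ν ≥ α / (4 * lam)` gives `4 * lam / α`, and the 3 in `e` makes it `12 * lam /
    -- α`.
    refine (div_le_div_of_nonneg_left h0 (by positivity) hν0).trans_eq ?_
    rw [hrpow, he]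
    field_simp
    ring
  · have := MPE.gradEstimator_le _ _ hmem
    have hDe : D = 4 * β * lam / α + 144 * lam ^ 2 * (α + 4 * β) / α ^ 2 * L *
        (N : ℝ) ^ (-(1 / 2) : ℝ) := by
      rw [hrpow, hD, he]
      field_simp
      ring
    rw [← hDe]
    linarith
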